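/- Let $\Sigma$ be a finite signature, $\mathcal V$ an infinite set of variables, and $\mathcal T$ the set of terms over $\Sigma$ and $\mathcal V$. A finite multi-distribution on a set $A$ is a finite multiset of pairs $(p:a)$ with $0<p\le 1$ and $a\in A$ whose probabilities sum to $1$. A probabilistic term rewrite system (PTRS) $\mathcal P$ is a finite set of rules $\ell\to\mu$, where $\ell\in\mathcal T\setminus\mathcal V$ and $\mu$ is a finite multi-distribution on $\mathcal T$ such that every variable of a term in $\mu$ occurs in $\ell$. One writes $s\to_{\mathcal P}\{p_1:t_1,\dots,p_k:t_k\}$ if there are a position $\pi$ of $s$, a rule $\ell\to\{p_1:r_1,\dots,p_k:r_k\}$ in $\mathcal P$ and a substitution $\sigma$ with $s|_\pi=\ell\sigma$ and $t_j=s[r_j\sigma]_\pi$ for all $j$. A $\mathcal P$-rewrite sequence tree ($\mathcal P$-RST) $\mathfrak T$ is a (possibly infinite) rooted tree whose nodes $v$ are labeled by a probability $p_v\in(0,1]$ and a term $t_v$, such that the root has probability $1$ and every node $v$ with successors $w_1,\dots,w_k$, $k\ge 1$, satisfies $t_v\to_{\mathcal P}\{\tfrac{p_{w_1}}{p_v}:t_{w_1},\dots,\tfrac{p_{w_k}}{p_v}:t_{w_k}\}$;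 leaves need not be normal forms. Let $|\mathfrak T|=\sum_{v\in\mathrm{Leaf}(\mathfrak T)}p_v$, let $\mathrm d(v)$ be the depth of $v$ (its distance from the root), let the height of $\mathfrak T$ be $\mathrm h(\mathfrak T)=\sup_v \mathrm d(v)\in\mathbb N\cup\{\infty\}$, and let $\mathrm{edl}(\mathfrak T)=\infty$ if $|\mathfrak T|<1$ and $\mathrm{edl}(\mathfrak T)=\sum_{v\in\mathrm{Leaf}(\mathfrak T)}\mathrm d(v)\,p_v$ otherwise. $\mathcal P$ is almost-surely terminating (AST) if $|\mathfrak T|=1$ for all $\mathcal P$-RSTs $\mathfrak T$, and positively almost-surely terminating (PAST) if $\mathrm{edl}(\mathfrak T)<\infty$ for all $\mathcal P$-RSTs $\mathfrak T$. For terms $t,s$, the term $t$ occurs in $s$ at a position $\pi$ of $s$ if $s|_\pi=t\sigma$ for some substitution $\sigma$. Two positions $\pi_1,\pi_2$ overlap w.r.t. $t$ if $\pi_1=\pi_2.\tau$ or $\pi_2=\pi_1.\tau$ for some position $\tau$ of a function symbol in $t$; they are orthogonal if neither is a prefix of the other. Let $\mathrm{maxOO}(t,s)$ be the maximal cardinality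 of a set of positions of $s$ at which $t$ occurs whose distinct elements are pairwise non-overlapping w.r.t. $t$ and pairwise orthogonal. **Theorem.** Let $\mathcal P$ be a PTRS and let $\mathfrak T$ be a (finite or infinite) $\mathcal P$-RST with $\mathrm h(\mathfrak T)>0$ whose root is labeled with the term $t$. 1. If $\sum_{v\in\mathrm{Leaf}(\mathfrak T)}p_v\cdot\mathrm{maxOO}(t,t_v)>1$, then $\mathcal P$ is not AST. 2. If $\sum_{v\in\mathrm{Leaf}(\mathfrak T)}p_v\cdot\mathrm{maxOO}(t,t_v)\ge 1$, then $\mathcal P$ is not PAST. (The sums are taken in $[0,\infty]$.) -/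

import Mathlib

open scoped ENNReal

universe u v w

namespace ProbRewriting

/-! ### Terms, positions, substitutions

Terms over a signature are Mathlib's first-order terms `L.Term V`, where `L.Functions n` is the
set of function symbols of arity `n` and `V` is the set of variables. Positions are lists of
natural numbers; the arguments of a function symbol are numbered from `0`. -/

section Terms

variable {L : FirstOrder.Language.{u, v}} {V : Type w}

/-- The subterm of a term at a position, `none` if this is not a position of the term. -/
def subtermAt : L.Term V → List ℕ → Option (L.Term V)
  | t, [] => some t
  | .var _, _ :: _ => none
  | .func (l := n) _ ts, i :: π => if h : i < n then subtermAt (ts ⟨i, h⟩) π else none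

/-- `replaceAt s π r` is the term `s[r]_π` (only used for positions `π` of `s`). -/
def replaceAt : L.Term V → List ℕ → L.Term V → L.Term V
  | _, [], r => r
  | .var x, _ :: _, _ => .var x
  | .func f ts, i :: π, r =>
      .func f (fun j => if (j : ℕ) = i then replaceAt (ts j) π r else ts j)

/-- The set of positions of a term. -/
def Pos (t : L.Term V) : Set (List ℕ) := {π | ∃ u, subtermAt t π = some u}

/-- The set of positions of a term that carry a function symbol. -/
def FunPos (t : L.Term V) : Set (List ℕ) :=
  {π | ∃ (n : ℕ) (f : L.Functions n) (ts : Fin n → L.Term V), subtermAt t π = some (.func f ts)}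

/-- The set of variables occurring in a term. -/
def vars (t : L.Term V) : Set V := {x | ∃ π, subtermAt t π = some (.var x)}

/-- `π₁` is above `π₂` if it is a (not necessarily proper) prefix of `π₂`; positions none of
which is above the other one are orthogonal. -/
def Orthogonal (π₁ π₂ : List ℕ) : Prop := ¬ π₁ <+: π₂ ∧ ¬ π₂ <+: π₁

variable (L V) in
/-- A substitution, i.e. a map from variables to terms with finite domain. -/
structure Substitution where
  /-- the underlying map -/
  toFun : V → L.Term V
  finite_dom : {x | toFun x ≠ .var x}.Finite

/-- Application of a substitution to a term. -/
def Substitution.apply (σ : Substitution L V) (t : L.Term V) : L.Term V := t.subst σ.toFun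

/-! ### Occurrences -/

/-- The term `t` occurs in `s` at position `π`. -/
def OccursAt (t : L.Term V) (π : List ℕ) (s : L.Term V) : Prop :=
  ∃ σ : Substitution L V, subtermAt s π = some (σ.apply t)

/-- Two positions are overlapping with respect to `t`. -/
def Overlapping (t : L.Term V) (π₁ π₂ : List ℕ) : Prop :=
  ∃ τ ∈ FunPos t, π₁ = π₂ ++ τ ∨ π₂ = π₁ ++ τ

/-- The set of all (finite) sets of pairwise non-overlapping occurrences of `t` in `s`. -/
def NO (t s : L.Term V) : Set (Finset (List ℕ)) :=
  {S | (S : Set (List ℕ)) ⊆ Pos s ∧ (∀ π ∈ S, OccursAt t π s) ∧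
    ∀ π₁ ∈ S, ∀ π₂ ∈ S, π₁ ≠ π₂ → ¬ Overlapping t π₁ π₂}

/-- The cardinalities of the sets of pairwise orthogonal occurrences of `t` in `s`. -/
def orthogonalCounts (t s : L.Term V) : Set ℕ :=
  {n | ∃ S ∈ NO t s, (∀ π₁ ∈ S, ∀ π₂ ∈ S, π₁ ≠ π₂ → Orthogonal π₁ π₂) ∧ S.card = n}

/-- The maximal number of pairwise orthogonal occurrences of `t` in `s`
(a maximum by `isGreatest_maxOO`). -/
noncomputable def maxOO (t s : L.Term V) : ℕ := sSup (orthogonalCounts t s)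

theorem finite_pos (t : L.Term V) : (Pos t).Finite := by
  induction t with
  | var x =>
    refine (Set.finite_singleton ([] : List ℕ)).subset ?_
    rintro (_ | ⟨i, π⟩) ⟨u, hu⟩
    · simp
    · simp [subtermAt] at hu
  | @func n f ts ih =>
    refine ((Set.finite_singleton ([] : List ℕ)).union
      (Set.finite_iUnion fun j : Fin n => (ih j).image (List.cons (j : ℕ)))).subset ?_
    rintro (_ | ⟨i, π⟩) ⟨u, hu⟩
    · simp
    · right
      by_cases h : i < n
      · simp only [subtermAt, h, dif_pos] at hu
        exact Set.mem_iUnion.2 ⟨⟨i, h⟩, π, ⟨u, hu⟩, rfl⟩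
      · simp [subtermAt, h] at hu

theorem isGreatest_maxOO (t s : L.Term V) : IsGreatest (orthogonalCounts t s) (maxOO t s) := by
  have hb : BddAbove (orthogonalCounts t s) := by
    refine ⟨(finite_pos s).toFinset.card, ?_⟩
    rintro n ⟨S, hS, -, rfl⟩
    exact Finset.card_le_card fun π hπ => (finite_pos s).mem_toFinset.2 (hS.1 hπ)
  have hne : (orthogonalCounts t s).Nonempty := ⟨0, ∅, by simp [NO], by simp, by simp⟩
  exact ⟨Nat.sSup_mem hne hb, fun n hn => le_csSup hb hn⟩

end Terms

/-! ### Probabilistic abstract reduction systems and rewrite sequence trees -/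

/-- A finite multi-distribution on `A`: a finite multiset of pairs `(p : a)` with `0 < p ≤ 1`
whose probabilities sum up to `1`. -/
structure FDist (A : Type u) where
  /-- the underlying multiset of pairs -/
  pairs : Multiset (ℝ × A)
  pos : ∀ q ∈ pairs, 0 < q.1
  le_one : ∀ q ∈ pairs, q.1 ≤ 1
  sum_eq_one : (pairs.map Prod.fst).sum = 1

/-- A probabilistic abstract reduction system on `A`. -/
abbrev PARS (A : Type u) : Type u := A → FDist A → Prop

/-- A (possibly infinite) rewrite sequence tree. Nodes are addressed by lists of natural numbers:
the root is `[]`, and the successors of the node `x` are `x ++ [0], …, x ++ [k - 1]`, where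
`k = arity x`. Values of `arity`, `prob`, `label` outside of `nodes` are irrelevant. -/
structure RST {A : Type u} (R : PARS A) where
  /-- the set of nodes -/
  nodes : Set (List ℕ)
  /-- the number of successors of a node -/
  arity : List ℕ → ℕ
  /-- the probability at a node -/
  prob : List ℕ → ℝ
  /-- the object at a node -/
  label : List ℕ → A
  root_mem : [] ∈ nodes
  append_mem_iff : ∀ (x : List ℕ) (i : ℕ), x ++ [i] ∈ nodes ↔ x ∈ nodes ∧ i < arity x
  prob_root : prob [] = 1
  prob_pos : ∀ x ∈ nodes, 0 < prob x
  prob_le_one : ∀ x ∈ nodes, prob x ≤ 1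
  step : ∀ x ∈ nodes, arity x ≠ 0 → ∃ μ : FDist A, R (label x) μ ∧
    μ.pairs = (Multiset.range (arity x)).map
      (fun i => (prob (x ++ [i]) / prob x, label (x ++ [i])))

namespace RST

variable {A : Type u} {R : PARS A}

/-- The object at the root. -/
def root (T : RST R) : A := T.label []

/-- The set of leaves, i.e. of nodes without successors. -/
def leaves (T : RST R) : Set (List ℕ) := {x | x ∈ T.nodes ∧ T.arity x = 0}

/-- The depth of a node, i.e. its distance from the root. -/
def depth (_T : RST R) (x : List ℕ) : ℕ := x.length

/-- The height of a tree, in `ℕ ∪ {∞}`. -/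
noncomputable def height (T : RST R) : ℕ∞ := ⨆ x : T.nodes, (T.depth x : ℕ∞)

/-- The termination probability of a tree. -/
noncomputable def termProb (T : RST R) : ℝ≥0∞ := ∑' x : T.leaves, ENNReal.ofReal (T.prob x)

/-- The expected derivation length of a tree. -/
noncomputable def edl (T : RST R) : ℝ≥0∞ :=
  if T.termProb < 1 then ∞
  else ∑' x : T.leaves, (T.depth x : ℝ≥0∞) * ENNReal.ofReal (T.prob x)

end RST

/-- Almost-sure termination. -/
def PARS.IsAST {A : Type u} (R : PARS A) : Prop := ∀ T : RST R, T.termProb = 1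

/-- Positive almost-sure termination. -/
def PARS.IsPAST {A : Type u} (R : PARS A) : Prop := ∀ T : RST R, T.edl < ∞

/-! ### Probabilistic term rewrite systems -/

/-- A probabilistic term rewrite rule. -/
structure ProbRule (L : FirstOrder.Language.{u, v}) (V : Type w) where
  /-- the left-hand side -/
  lhs : L.Term V
  /-- the right-hand side -/
  rhs : FDist (L.Term V)
  lhs_not_var : ∀ x : V, lhs ≠ .var x
  vars_subset : ∀ q ∈ rhs.pairs, vars q.2 ⊆ vars lhs

/-- A probabilistic term rewrite system: a finite set of probabilistic rules. -/
abbrev PTRS (L : FirstOrder.Language.{u, v}) (V : Type w) : Type (max u w) :=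
  Finset (ProbRule L V)

/-- The PARS on terms that is induced by a PTRS. -/
def PTRS.toPARS {L : FirstOrder.Language.{u, v}} {V : Type w} (P : PTRS L V) :
    PARS (L.Term V) :=
  fun s μ => ∃ π : List ℕ, ∃ ρ ∈ P, ∃ σ : Substitution L V,
    subtermAt s π = some (σ.apply ρ.lhs) ∧
    μ.pairs = ρ.rhs.pairs.map (fun q => (q.1, replaceAt s π (σ.apply q.2)))

end ProbRewriting

/-!
Copies of the tree `T` are glued together. If `t` occurs at `k` pairwise orthogonal positions of a
term, then `T` can be replayed at one of them, without touching the other ones; this leads to terms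
with `k - 1 + maxOO t (T.label v)` pairwise orthogonal occurrences of `t`, for the leaves `v` of
`T`. Repeating this gives a rewrite sequence tree whose shape is that of a branching process: each
individual (an occurrence of `t`) is replaced by `maxOO t (T.label v)` new ones with probability
`T.prob v`, and the tree has leaves only where no individual is left. The process is
`RST.branching`, its steps are simulated by rewriting in `realizes_step`, and
`RST.exists_of_simulation` turns a simulated process into a tree.

* If the mean number of new individuals exceeds `1`, then its generating function takes a value
  `≤ q` at some `q < 1` (`exists_tsum_mul_pow_le`). With this, `q` to the number of individuals does
  not increase on average, and therefore the process dies out with probability at most `q`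
  (`RST.branching_lim_one_le`).
* Suppose that the mean is at least `1` and the system is positively almost-surely terminating. Then
  the process dies out almost surely, and the individuals can be treated one after the other, so
  that the expected number of steps for `k` individuals is at least `k * W`, where `W` is the one
  for a single individual (`RST.mul_le_branching_steps`). The first copy of `T` takes at least one
  step, as `T` has positive height, so that `1 + W ≤ W` and `W = ∞`
  (`RST.branching_steps_eq_top`). When all subtrees terminate almost surely, the expected derivation
  length is at least the expected number of steps (`RST.lim_steps_le_edl`), so it is infinite.

All expectations are suprema of the expectations truncated after `n` steps (`Proc.val`), and the
inequalities are shown by induction on `n`. Sums over the leaves of a tree are of this form by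
`RST.tsum_leaves`.
-/

namespace ProbRewriting

/-! ### Positions, replacement and substitution -/

section Terms

variable {L : FirstOrder.Language.{u, v}} {V : Type w}

theorem subtermAt_nil (s : L.Term V) : subtermAt s [] = some s := by
  cases s <;> simp [subtermAt]

theorem replaceAt_nil (s r : L.Term V) : replaceAt s [] r = r := by
  cases s <;> simp [replaceAt]

theorem subtermAt_append (s : L.Term V) (π τ : List ℕ) :
    subtermAt s (π ++ τ) = (subtermAt s π).bind (subtermAt · τ) := by
  induction π generalizing s with
  | nil => simp [subtermAt_nil]
  | cons i π ih =>
    cases s with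
    | var x => simp [subtermAt]
    | @func n f ts =>
      by_cases h : i < n
      · simp [subtermAt, h, ih]
      · simp [subtermAt, h]

theorem subtermAt_subst {s u : L.Term V} {π : List ℕ} (h : subtermAt s π = some u)
    (σ : V → L.Term V) : subtermAt (s.subst σ) π = some (u.subst σ) := by
  induction π generalizing s with
  | nil =>
    rw [subtermAt_nil] at h ⊢
    rw [Option.some.inj h]
  | cons i π ih =>
    cases s with
    | var x => simp [subtermAt] at h
    | @func n f ts =>
      by_cases hi : i < n
      · simp only [subtermAt, hi, dif_pos, FirstOrder.Language.Term.subst] at h ⊢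
        exact ih h
      · simp [subtermAt, hi] at h

theorem subst_subst (s : L.Term V) (σ τ : V → L.Term V) :
    (s.subst σ).subst τ = s.subst (fun x => (σ x).subst τ) := by
  induction s with
  | var x => rfl
  | func f ts ih => simp [FirstOrder.Language.Term.subst, ih]

theorem subst_var (s : L.Term V) : s.subst FirstOrder.Language.Term.var = s := by
  induction s with
  | var x => rfl
  | func f ts ih => simp [FirstOrder.Language.Term.subst, ih]

theorem subtermAt_replaceAt_self {s u : L.Term V} {π : List ℕ} (h : subtermAt s π = some u)
    (r : L.Term V) : subtermAt (replaceAt s π r) π = some r := by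
  induction π generalizing s with
  | nil => rw [replaceAt_nil, subtermAt_nil]
  | cons i π ih =>
    cases s with
    | var x => simp [subtermAt] at h
    | @func n f ts =>
      by_cases hi : i < n
      · simp only [subtermAt, replaceAt, hi, dif_pos, if_true] at h ⊢
        exact ih h
      · simp [subtermAt, hi] at h

theorem subtermAt_replaceAt_of_orthogonal (s r : L.Term V) {π τ : List ℕ}
    (h : Orthogonal π τ) : subtermAt (replaceAt s π r) τ = subtermAt s τ := by
  induction π generalizing s τ with
  | nil => exact absurd List.nil_prefix h.1
  | cons i π ih =>
    cases s with
    | var x => simp [replaceAt]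
    | @func n f ts =>
      cases τ with
      | nil => exact absurd List.nil_prefix h.2
      | cons j τ =>
        by_cases hj : j < n
        · simp only [subtermAt, replaceAt, hj, dif_pos]
          by_cases hij : j = i
          · subst hij
            rw [if_pos rfl]
            refine ih _ ⟨fun h' => h.1 ?_, fun h' => h.2 ?_⟩
            · simpa [List.cons_prefix_cons] using h'
            · simpa [List.cons_prefix_cons] using h'
          · rw [if_neg hij]
        · simp [subtermAt, replaceAt, hj]

theorem replaceAt_append {s u : L.Term V} {π : List ℕ} (h : subtermAt s π = some u)
    (τ : List ℕ) (r : L.Term V) :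
    replaceAt s (π ++ τ) r = replaceAt s π (replaceAt u τ r) := by
  induction π generalizing s with
  | nil =>
    rw [subtermAt_nil] at h
    rw [Option.some.inj h, replaceAt_nil, List.nil_append]
  | cons i π ih =>
    cases s with
    | var x => simp [subtermAt] at h
    | @func n f ts =>
      by_cases hi : i < n
      · simp only [subtermAt, hi, dif_pos] at h
        simp only [List.cons_append, replaceAt]
        congr 1
        funext j
        by_cases hj : (j : ℕ) = i
        · subst hj
          simp [ih h]
        · simp [hj]
      · simp [subtermAt, hi] at h

theorem replaceAt_subst {s u : L.Term V} {π : List ℕ} (h : subtermAt s π = some u)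
    (r : L.Term V) (σ : V → L.Term V) :
    (replaceAt s π r).subst σ = replaceAt (s.subst σ) π (r.subst σ) := by
  induction π generalizing s with
  | nil => rw [replaceAt_nil, replaceAt_nil]
  | cons i π ih =>
    cases s with
    | var x => simp [subtermAt] at h
    | @func n f ts =>
      by_cases hi : i < n
      · simp only [subtermAt, hi, dif_pos] at h
        simp only [replaceAt, FirstOrder.Language.Term.subst]
        congr 1
        funext j
        by_cases hj : (j : ℕ) = i
        · subst hj
          simp [ih h]
        · simp [hj]
      · simp [subtermAt, hi] at h

/-- Composition of substitutions: first `σ`, then `τ`. -/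
def Substitution.comp (τ σ : Substitution L V) : Substitution L V where
  toFun x := (σ.toFun x).subst τ.toFun
  finite_dom := by
    refine (σ.finite_dom.union τ.finite_dom).subset fun x hx => ?_
    by_contra hn
    simp only [Set.mem_union, Set.mem_ofPred_eq, not_or, not_not] at hn
    exact hx (by rw [hn.1]; exact hn.2)

theorem Substitution.comp_apply (τ σ : Substitution L V) (s : L.Term V) :
    (τ.comp σ).apply s = τ.apply (σ.apply s) :=
  (subst_subst s σ.toFun τ.toFun).symm

variable (L V) in
/-- The identity substitution. -/
def Substitution.id : Substitution L V where
  toFun := .var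
  finite_dom := by simp

theorem Orthogonal.symm {π τ : List ℕ} (h : Orthogonal π τ) : Orthogonal τ π := ⟨h.2, h.1⟩

theorem Orthogonal.append_left {π τ : List ℕ} (h : Orthogonal π τ) (π' : List ℕ) :
    Orthogonal (π ++ π') τ := by
  refine ⟨fun h' => h.1 ((List.prefix_append π π').trans h'), fun h' => ?_⟩
  rcases List.prefix_or_prefix_of_prefix h' (List.prefix_append π π') with h1 | h1
  exacts [h.2 h1, h.1 h1]

theorem Orthogonal.append_append {π τ : List ℕ} (h : Orthogonal π τ) (ρ : List ℕ) :
    Orthogonal (ρ ++ π) (ρ ++ τ) := by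
  simpa [Orthogonal, List.prefix_append_right_inj] using h

/-- A rewrite step at an instance of `s` inside a term `a`: closure of the rewrite relation under
contexts and substitutions. -/
theorem PTRS.toPARS_replaceAt {P : PTRS L V} {s : L.Term V} {μ : FDist (L.Term V)}
    (h : P.toPARS s μ) {a : L.Term V} {π : List ℕ} {σ : Substitution L V}
    (ha : subtermAt a π = some (σ.apply s)) :
    ∃ μ' : FDist (L.Term V), P.toPARS a μ' ∧
      μ'.pairs = μ.pairs.map (fun q => (q.1, replaceAt a π (σ.apply q.2))) := by
  obtain ⟨π₀, ρ, hρ, σ₀, hs, hμ⟩ := h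
  refine ⟨⟨μ.pairs.map (fun q => (q.1, replaceAt a π (σ.apply q.2))), ?_, ?_, ?_⟩,
    ⟨π ++ π₀, ρ, hρ, σ.comp σ₀, ?_, ?_⟩, rfl⟩
  · intro q hq
    obtain ⟨q', hq', rfl⟩ := Multiset.mem_map.1 hq
    exact μ.pos q' hq'
  · intro q hq
    obtain ⟨q', hq', rfl⟩ := Multiset.mem_map.1 hq
    exact μ.le_one q' hq'
  · simpa [Multiset.map_map, Function.comp_def] using μ.sum_eq_one
  · rw [subtermAt_append, ha, Option.bind_some, Substitution.comp_apply]
    exact subtermAt_subst hs σ.toFun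
  · simp only [hμ, Multiset.map_map]
    refine Multiset.map_congr rfl fun q _ => ?_
    simp only [Function.comp_apply]
    rw [replaceAt_append ha, Substitution.comp_apply, Substitution.apply, Substitution.apply,
      replaceAt_subst hs]
    rfl

end Terms

/-! ### Weighted processes -/

/-- A finitely branching process with weighted transitions on a type `S` of states: the successors
of `s` are `next s i` for `i < arity s`, with weights `wt s i`. A state of arity `0` is final. -/
structure Proc (S : Type*) where
  /-- the number of successors of a state -/
  arity : S → ℕ
  /-- the weights of the successors -/
  wt : S → ℕ → ℝ
  /-- the successors -/
  next : S → ℕ → S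

namespace Proc

variable {S S' : Type*} (Q : Proc S)

/-- The expected value, within the first `n` steps, of the reward that pays `c` for each step and
`f s` when the final state `s` is reached. -/
noncomputable def val (c : ℝ≥0∞) (f : S → ℝ≥0∞) : ℕ → S → ℝ≥0∞
  | 0, s => if Q.arity s = 0 then f s else 0
  | n + 1, s => if Q.arity s = 0 then f s else
      c + ∑ i ∈ Finset.range (Q.arity s), ENNReal.ofReal (Q.wt s i) * val c f n (Q.next s i)

/-- The expected total reward. For `c = 0` and `f = 1` this is the probability of reaching a final
state, for `c = 1` and `f = 0` it is the expected number of steps. -/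
noncomputable def lim (c : ℝ≥0∞) (f : S → ℝ≥0∞) (s : S) : ℝ≥0∞ := ⨆ n, Q.val c f n s

variable {Q} {c : ℝ≥0∞} {f : S → ℝ≥0∞} {s : S}

theorem val_final (h : Q.arity s = 0) (n : ℕ) : Q.val c f n s = f s := by
  cases n <;> simp [val, h]

theorem val_zero (h : Q.arity s ≠ 0) : Q.val c f 0 s = 0 := by simp [val, h]

theorem val_succ (h : Q.arity s ≠ 0) (n : ℕ) : Q.val c f (n + 1) s =
    c + ∑ i ∈ Finset.range (Q.arity s), ENNReal.ofReal (Q.wt s i) * Q.val c f n (Q.next s i) := by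
  simp [val, h]

theorem val_le_succ (n : ℕ) (s : S) : Q.val c f n s ≤ Q.val c f (n + 1) s := by
  induction n generalizing s with
  | zero =>
    by_cases h : Q.arity s = 0
    · rw [val_final h, val_final h]
    · simp [val_zero h]
  | succ n ih =>
    by_cases h : Q.arity s = 0
    · rw [val_final h, val_final h]
    · rw [val_succ h, val_succ h]
      gcongr
      exact ih _

theorem monotone_val (s : S) : Monotone fun n => Q.val c f n s :=
  monotone_nat_of_le_succ fun n => val_le_succ n s

theorem val_le_lim (n : ℕ) (s : S) : Q.val c f n s ≤ Q.lim c f s :=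
  le_iSup (fun n => Q.val c f n s) n

theorem lim_final (h : Q.arity s = 0) : Q.lim c f s = f s := by
  simp [lim, val_final h]

theorem lim_eq (h : Q.arity s ≠ 0) : Q.lim c f s =
    c + ∑ i ∈ Finset.range (Q.arity s), ENNReal.ofReal (Q.wt s i) * Q.lim c f (Q.next s i) := by
  have h1 : Q.lim c f s = ⨆ n, Q.val c f (n + 1) s :=
    ((monotone_val (c := c) (f := f) s).iSup_nat_add 1).symm
  rw [h1]
  simp only [val_succ h, lim, ENNReal.mul_iSup]
  rw [← ENNReal.add_iSup, ENNReal.finsetSum_iSup_of_monotone]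
  exact fun i m n hmn => mul_le_mul_right (monotone_val _ hmn) _

/-- Rewards are preserved by maps that respect the transitions between the states that satisfy an
invariant `p`. -/
theorem val_eq_of_map {Q' : Proc S'} {f' : S' → ℝ≥0∞} (p : S → Prop) (φ : S → S')
    (harity : ∀ s, p s → Q'.arity (φ s) = Q.arity s)
    (hwt : ∀ s, p s → ∀ i < Q.arity s, Q'.wt (φ s) i = Q.wt s i)
    (hnext : ∀ s, p s → ∀ i < Q.arity s, p (Q.next s i) ∧ Q'.next (φ s) i = φ (Q.next s i))
    (hf : ∀ s, p s → f s = f' (φ s)) (n : ℕ) (s : S) (hs : p s) :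
    Q.val c f n s = Q'.val c f' n (φ s) := by
  induction n generalizing s with
  | zero => simp [val, harity s hs, hf s hs]
  | succ n ih =>
    simp only [val, harity s hs, hf s hs]
    congr 2
    refine Finset.sum_congr rfl fun i hi => ?_
    have hi := Finset.mem_range.1 hi
    rw [hwt s hs i hi, (hnext s hs i hi).2, ih _ (hnext s hs i hi).1]

end Proc

/-! ### Rewrite sequence trees as processes -/

namespace RST

variable {A : Type u} {R : PARS A} (T : RST R)

/-- The process that walks down a rewrite sequence tree. -/
noncomputable def proc : Proc (List ℕ) where
  arity := T.arity
  wt x i := T.prob (x ++ [i]) / T.prob x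
  next x i := x ++ [i]

theorem mem_of_append_mem (x y : List ℕ) (h : x ++ y ∈ T.nodes) : x ∈ T.nodes := by
  induction y using List.reverseRecOn with
  | nil => simpa using h
  | append_singleton y i ih =>
    rw [← List.append_assoc] at h
    exact ih ((T.append_mem_iff _ _).1 h).1

theorem wt_pos {x : List ℕ} (hx : x ∈ T.nodes) {i : ℕ} (hi : i < T.arity x) :
    0 < T.prob (x ++ [i]) / T.prob x :=
  div_pos (T.prob_pos _ ((T.append_mem_iff _ _).2 ⟨hx, hi⟩)) (T.prob_pos _ hx)

theorem sum_wt {x : List ℕ} (hx : x ∈ T.nodes) (h : T.arity x ≠ 0) :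
    ∑ i ∈ Finset.range (T.arity x), ENNReal.ofReal (T.prob (x ++ [i]) / T.prob x) = 1 := by
  obtain ⟨μ, -, hμ⟩ := T.step x hx h
  rw [← ENNReal.ofReal_sum_of_nonneg fun i hi => (T.wt_pos hx (Finset.mem_range.1 hi)).le]
  have := μ.sum_eq_one
  rw [hμ, Multiset.map_map] at this
  rw [← ENNReal.ofReal_one, ← this]
  rfl

/-- The contribution of the node `x` to the sum of `prob x * f x` over the leaves. It is defined for
all lists `x`, so that sums over leaves become sums over all lists. -/
noncomputable def leafTerm (f : List ℕ → ℝ≥0∞) (x : List ℕ) : ℝ≥0∞ :=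
  T.leaves.indicator (fun x => ENNReal.ofReal (T.prob x) * f x) x

theorem tsum_list (F : List ℕ → ℝ≥0∞) :
    ∑' y, F y = F [] + ∑' i, ∑' y, F (i :: y) := by
  let e : Unit ⊕ (ℕ × List ℕ) ≃ List ℕ :=
    { toFun := Sum.elim (fun _ => []) fun p => p.1 :: p.2
      invFun := fun l => l.casesOn (Sum.inl ()) fun i y => Sum.inr (i, y)
      left_inv := by rintro (_ | ⟨i, y⟩) <;> rfl
      right_inv := by rintro (_ | ⟨i, y⟩) <;> rfl }
  rw [← e.tsum_eq F, Summable.tsum_sum ENNReal.summable ENNReal.summable, ENNReal.tsum_prod']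
  simp [e]

theorem leafTerm_of_notMem {f : List ℕ → ℝ≥0∞} {x : List ℕ} (hx : x ∉ T.nodes) :
    T.leafTerm f x = 0 :=
  Set.indicator_of_notMem (fun h => hx h.1) _

theorem leafTerm_append_cons {f : List ℕ → ℝ≥0∞} {x : List ℕ} {i : ℕ} (hi : ¬ i < T.arity x)
    (y : List ℕ) : T.leafTerm f (x ++ i :: y) = 0 := by
  refine T.leafTerm_of_notMem fun h => hi ?_
  rw [← List.singleton_append, ← List.append_assoc] at h
  exact ((T.append_mem_iff _ _).1 (T.mem_of_append_mem _ _ h)).2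

theorem leafTerm_of_inner {f : List ℕ → ℝ≥0∞} {x : List ℕ} (h : T.arity x ≠ 0) :
    T.leafTerm f x = 0 :=
  Set.indicator_of_notMem (fun h' : x ∈ T.leaves => h h'.2) _

theorem tsum_leafTerm_length_le_of_leaf (f : List ℕ → ℝ≥0∞) (n : ℕ) {x : List ℕ}
    (hx : x ∈ T.nodes) (h : T.arity x = 0) :
    ∑' y : List ℕ, (if y.length ≤ n then T.leafTerm f (x ++ y) else 0) =
      ENNReal.ofReal (T.prob x) * T.proc.val 0 f n x := by
  have hroot : T.leafTerm f x = ENNReal.ofReal (T.prob x) * f x :=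
    Set.indicator_of_mem (show x ∈ T.leaves from ⟨hx, h⟩) _
  rw [Proc.val_final h, tsum_list]
  simp [hroot, fun i y => T.leafTerm_append_cons (f := f) (x := x) (i := i) (by simp [h]) y]

/-- The truncated rewards of the process are the sums over the leaves below `x` at distance at most
`n` from `x`. -/
theorem tsum_leafTerm_length_le (f : List ℕ → ℝ≥0∞) (n : ℕ) (x : List ℕ) (hx : x ∈ T.nodes) :
    ∑' y : List ℕ, (if y.length ≤ n then T.leafTerm f (x ++ y) else 0) =
      ENNReal.ofReal (T.prob x) * T.proc.val 0 f n x := by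
  induction n generalizing x with
  | zero =>
    by_cases h : T.arity x = 0
    · exact T.tsum_leafTerm_length_le_of_leaf f 0 hx h
    · rw [Proc.val_zero h, tsum_list]
      simp [T.leafTerm_of_inner h]
  | succ n ih =>
    by_cases h : T.arity x = 0
    · exact T.tsum_leafTerm_length_le_of_leaf f (n + 1) hx h
    rw [Proc.val_succ h, tsum_list, tsum_eq_sum (s := Finset.range (T.arity x))]
    · simp only [List.append_nil, T.leafTerm_of_inner h, ite_self, zero_add, Finset.mul_sum]
      refine Finset.sum_congr rfl fun i hi => ?_
      have key := ih _ ((T.append_mem_iff _ _).2 ⟨hx, Finset.mem_range.1 hi⟩)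
      have hwt : ENNReal.ofReal (T.prob x) * ENNReal.ofReal (T.proc.wt x i) =
          ENNReal.ofReal (T.prob (x ++ [i])) := by
        rw [← ENNReal.ofReal_mul (T.prob_pos x hx).le]
        congr 1
        exact mul_div_cancel₀ _ (T.prob_pos x hx).ne'
      rw [← mul_assoc, hwt]
      simpa [proc] using key
    · intro i hi
      simp [T.leafTerm_append_cons (f := f) (x := x) (i := i) (by simpa using hi)]

theorem tsum_leaves (f : List ℕ → ℝ≥0∞) :
    ∑' x : T.leaves, ENNReal.ofReal (T.prob x) * f x = T.proc.lim 0 f [] := by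
  have h1 : ∑' x : T.leaves, ENNReal.ofReal (T.prob x) * f x = ∑' y, T.leafTerm f y :=
    tsum_subtype T.leaves (fun x => ENNReal.ofReal (T.prob x) * f x)
  have h2 (n : ℕ) : ∑' y : List ℕ, (if y.length ≤ n then T.leafTerm f y else 0) =
      T.proc.val 0 f n [] := by
    simpa [T.prob_root] using T.tsum_leafTerm_length_le f n [] T.root_mem
  rw [h1]
  refine le_antisymm ?_ (iSup_le fun n => ?_)
  · rw [ENNReal.tsum_eq_iSup_sum]
    refine iSup_le fun F => ?_
    refine le_trans ?_ (Proc.val_le_lim (F.sup List.length) [])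
    rw [← h2]
    refine le_trans (le_of_eq ?_) (ENNReal.sum_le_tsum F)
    exact Finset.sum_congr rfl fun y hy => (if_pos (Finset.le_sup (f := List.length) hy)).symm
  · rw [← h2]
    refine ENNReal.tsum_le_tsum fun y => ?_
    split_ifs <;> simp

theorem termProb_eq : T.termProb = T.proc.lim 0 1 [] := by
  simp [← T.tsum_leaves, termProb]

theorem proc_val_one_le (n : ℕ) (x : List ℕ) (hx : x ∈ T.nodes) : T.proc.val 0 1 n x ≤ 1 := by
  induction n generalizing x with
  | zero => by_cases h : T.proc.arity x = 0 <;> simp [Proc.val, h]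
  | succ n ih =>
    by_cases h : T.proc.arity x = 0
    · simp [Proc.val, h]
    · rw [Proc.val_succ h, zero_add]
      refine le_of_le_of_eq (Finset.sum_le_sum fun i hi => ?_) (T.sum_wt hx h)
      exact mul_le_of_le_one_right' (ih _ ((T.append_mem_iff _ _).2 ⟨hx, Finset.mem_range.1 hi⟩))

theorem termProb_le_one : T.termProb ≤ 1 := by
  rw [termProb_eq]
  exact iSup_le fun n => T.proc_val_one_le n [] T.root_mem

/-- If the subtrees below all nodes terminate almost surely, then the expected derivation length is
at least the expected number of steps. -/
theorem lim_steps_le_edl (h1 : ∀ x ∈ T.nodes, 1 ≤ T.proc.lim 0 1 x) :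
    T.proc.lim 1 0 [] ≤ T.edl := by
  let d : List ℕ → ℝ≥0∞ := fun x => (x.length : ℝ≥0∞)
  have hd : ∀ n, ∀ x ∈ T.nodes, d x * T.proc.val 0 1 n x ≤ T.proc.val 0 d n x := by
    intro n
    induction n with
    | zero =>
      intro x hx
      by_cases h : T.proc.arity x = 0 <;> simp [Proc.val, h]
    | succ n ih =>
      intro x hx
      by_cases h : T.proc.arity x = 0
      · simp [Proc.val, h]
      · rw [Proc.val_succ h, Proc.val_succ h, zero_add, zero_add, Finset.mul_sum]
        refine Finset.sum_le_sum fun i hi => ?_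
        rw [mul_left_comm]
        gcongr
        refine le_trans ?_ (ih _ ((T.append_mem_iff _ _).2 ⟨hx, Finset.mem_range.1 hi⟩))
        gcongr
        simp [d, proc]
  have hd' : ∀ x ∈ T.nodes, d x ≤ T.proc.lim 0 d x := by
    intro x hx
    calc d x ≤ d x * T.proc.lim 0 1 x := le_mul_of_one_le_right' (h1 x hx)
      _ = ⨆ n, d x * T.proc.val 0 1 n x := ENNReal.mul_iSup ..
      _ ≤ T.proc.lim 0 d x := iSup_mono fun n => hd n x hx
  have key : ∀ n, ∀ x ∈ T.nodes, d x + T.proc.val 1 0 n x ≤ T.proc.lim 0 d x := by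
    intro n
    induction n with
    | zero =>
      intro x hx
      simpa [Proc.val] using hd' x hx
    | succ n ih =>
      intro x hx
      by_cases h : T.proc.arity x = 0
      · simpa [Proc.val, h] using hd' x hx
      · have hsplit : d x + 1 = ∑ i ∈ Finset.range (T.proc.arity x),
            ENNReal.ofReal (T.proc.wt x i) * (d x + 1) := by
          rw [← Finset.sum_mul]
          exact (one_mul _).symm.trans (congrArg (· * (d x + 1)) (T.sum_wt hx h).symm)
        rw [Proc.val_succ h, Proc.lim_eq h, zero_add, ← add_assoc, hsplit,
          ← Finset.sum_add_distrib]
        refine Finset.sum_le_sum fun i hi => ?_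
        have := ih _ ((T.append_mem_iff _ _).2 ⟨hx, Finset.mem_range.1 hi⟩)
        rw [← mul_add]
        refine mul_le_mul_right (le_trans (le_of_eq ?_) this) _
        simp [d, proc]
  unfold edl
  split_ifs with h
  · exact le_top
  · have h2 : ∑' x : T.leaves, (T.depth x : ℝ≥0∞) * ENNReal.ofReal (T.prob x) =
        T.proc.lim 0 d [] := by
      rw [← T.tsum_leaves]
      exact tsum_congr fun x => mul_comm _ _
    rw [h2]
    exact iSup_le fun n => le_trans (by simp) (key n [] T.root_mem)

/-- Coinduction principle: if every step of a process on `S` can be simulated by the rewrite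
relation along the relation `Inv`, then the unfolding of the process is a rewrite sequence tree. -/
theorem exists_of_simulation {S : Type*} (Q : Proc S) (Inv : A → S → Prop)
    (hstep : ∀ a s, Inv a s → Q.arity s ≠ 0 → ∃ b : ℕ → A,
      (∀ i < Q.arity s, Inv (b i) (Q.next s i)) ∧ ∃ μ : FDist A, R a μ ∧
        μ.pairs = (Multiset.range (Q.arity s)).map (fun i => (Q.wt s i, b i)))
    (a : A) (s : S) (h : Inv a s) :
    ∃ (T : RST R) (φ : List ℕ → S), φ [] = s ∧
      (∀ x ∈ T.nodes, Inv (T.label x) (φ x)) ∧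
      ∀ c f n, ∀ x ∈ T.nodes, T.proc.val c (f ∘ φ) n x = Q.val c f n (φ x) := by
  have : Nonempty (ℕ → A) := ⟨fun _ => a⟩
  have : Nonempty (FDist A) := ⟨⟨{(1, a)}, by simp, by simp, by simp⟩⟩
  choose! b hb μ hR hμ using hstep
  -- the probability, the object and the state at a node
  let ψ : List ℕ → ℝ × A × S := fun x =>
    x.foldl (fun p i => (p.1 * Q.wt p.2.2 i, b p.2.1 p.2.2 i, Q.next p.2.2 i)) (1, a, s)
  have hψ (x : List ℕ) (i : ℕ) : ψ (x ++ [i]) = ((ψ x).1 * Q.wt (ψ x).2.2 i,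
      b (ψ x).2.1 (ψ x).2.2 i, Q.next (ψ x).2.2 i) := by simp [ψ]
  let N : Set (List ℕ) := {x | ∀ y i, y ++ [i] <+: x → i < Q.arity (ψ y).2.2}
  have hN (x : List ℕ) (i : ℕ) : x ++ [i] ∈ N ↔ x ∈ N ∧ i < Q.arity (ψ x).2.2 := by
    refine ⟨fun h => ⟨fun y j hy => h y j (hy.trans (List.prefix_append _ _)),
      h x i List.prefix_rfl⟩, fun h y j hy => ?_⟩
    rcases List.prefix_concat_iff.1 hy with hy | hy
    · obtain ⟨rfl, hji⟩ := List.append_inj' hy rfl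
      cases hji
      exact h.2
    · exact h.1 y j hy
  have hwt (a : A) (s : S) (h : Inv a s) (i : ℕ) (hi : i < Q.arity s) :
      0 < Q.wt s i ∧ Q.wt s i ≤ 1 := by
    have hmem : (Q.wt s i, b a s i) ∈ (μ a s).pairs := by
      rw [hμ a s h (by omega)]
      exact Multiset.mem_map.2 ⟨i, Multiset.mem_range.2 hi, rfl⟩
    exact ⟨(μ a s).pos _ hmem, (μ a s).le_one _ hmem⟩
  have hinv (x : List ℕ) (hx : x ∈ N) :
      Inv (ψ x).2.1 (ψ x).2.2 ∧ 0 < (ψ x).1 ∧ (ψ x).1 ≤ 1 := by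
    induction x using List.reverseRecOn with
    | nil => exact ⟨h, one_pos, le_rfl⟩
    | append_singleton x i ih =>
      obtain ⟨hx, hi⟩ := (hN x i).1 hx
      obtain ⟨h1, h2, h3⟩ := ih hx
      obtain ⟨h4, h5⟩ := hwt _ _ h1 i hi
      rw [hψ]
      exact ⟨hb _ _ h1 (by omega) i hi, mul_pos h2 h4, mul_le_one₀ h3 h4.le h5⟩
  have hdiv (x : List ℕ) (hx : x ∈ N) (i : ℕ) :
      (ψ (x ++ [i])).1 / (ψ x).1 = Q.wt (ψ x).2.2 i := by
    rw [hψ]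
    exact mul_div_cancel_left₀ _ (hinv x hx).2.1.ne'
  let T : RST R :=
    { nodes := N
      arity := fun x => Q.arity (ψ x).2.2
      prob := fun x => (ψ x).1
      label := fun x => (ψ x).2.1
      root_mem := fun y i hy => by simp at hy
      append_mem_iff := hN
      prob_root := rfl
      prob_pos := fun x hx => (hinv x hx).2.1
      prob_le_one := fun x hx => (hinv x hx).2.2
      step := fun x hx h0 => by
        refine ⟨μ (ψ x).2.1 (ψ x).2.2, hR _ _ (hinv x hx).1 h0, ?_⟩
        rw [hμ _ _ (hinv x hx).1 h0]
        refine Multiset.map_congr rfl fun i _ => ?_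
        rw [hdiv x hx i, hψ] }
  refine ⟨T, fun x => (ψ x).2.2, rfl, fun x hx => (hinv x hx).1, fun c f n x hx => ?_⟩
  refine Proc.val_eq_of_map (· ∈ N) (fun x => (ψ x).2.2) (fun _ _ => rfl) ?_ ?_
    (fun _ _ => rfl) n x hx
  · exact fun x hx i _ => (hdiv x hx i).symm
  · exact fun x hx i hi => ⟨(hN x i).2 ⟨hx, hi⟩, (congrArg (·.2.2) (hψ x i)).symm⟩

theorem arity_root_ne_zero (h : 0 < T.height) : T.arity [] ≠ 0 := by
  intro h0
  refine h.ne' (le_antisymm (iSup_le fun x => ?_) zero_le)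
  obtain ⟨x, hx⟩ := x
  rcases x with _ | ⟨i, y⟩
  · simp [depth]
  · have h1 : [i] ∈ T.nodes := T.mem_of_append_mem [i] y hx
    have := ((T.append_mem_iff [] i).1 h1).2
    omega

/-! ### The embedded branching process -/

/-- The state of the branching process in which `k` copies of the root of a tree wait to be
processed. A state `some (k, v)` says that one copy has been developed to the inner node `v` and
`k` further ones are waiting; `none` is the final state without copies. -/
def start : ℕ → Option (ℕ × List ℕ)
  | 0 => none
  | k + 1 => some (k, [])

/-- The state reached when the current copy is developed to the node `v` while `k` copies are
waiting: a leaf `v` is replaced by `m v` new copies. -/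
def enter (m : List ℕ → ℕ) (k : ℕ) (v : List ℕ) : Option (ℕ × List ℕ) :=
  if T.arity v = 0 then start (k + m v) else some (k, v)

/-- The branching process that develops copies of the tree `T` one after the other, where every
leaf `v` gives rise to `m v` new copies. -/
noncomputable def branching (m : List ℕ → ℕ) : Proc (Option (ℕ × List ℕ)) where
  arity
    | none => 0
    | some (_, v) => T.arity v
  wt
    | none, _ => 0
    | some (_, v), i => T.proc.wt v i
  next
    | none, _ => none
    | some (k, v), i => T.enter m k (v ++ [i])

variable {T} {m : List ℕ → ℕ}

theorem enter_inner (hroot : T.arity [] ≠ 0) (k : ℕ) (v : List ℕ) :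
    ∀ j x, T.enter m k v = some (j, x) → T.arity x ≠ 0 := by
  unfold enter
  split_ifs with h
  · rcases k + m v with _ | i
    · rintro j x ⟨⟩
    · rintro j x ⟨⟩
      exact hroot
  · rintro j x ⟨⟩
    exact h

/-- If the generating function of the number of new copies has a value at most `q` at `q`, then the
branching process dies out with probability at most `q`. -/
theorem branching_lim_one_le {q : ℝ≥0∞} (hroot : T.arity [] ≠ 0)
    (hq : T.proc.lim 0 (fun v => q ^ m v) [] ≤ q) :
    (T.branching m).lim 0 1 (some (0, [])) ≤ q := by
  let g := T.proc.lim 0 fun v => q ^ m v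
  -- `H` does not increase on average along the process and is `1` at the final state, so it bounds
  -- the probability of reaching the final state
  let H : Option (ℕ × List ℕ) → ℝ≥0∞ := fun s => s.elim 1 fun p => q ^ p.1 * g p.2
  have henter (k : ℕ) (v : List ℕ) : H (T.enter m k v) ≤ q ^ k * g v := by
    unfold enter
    split_ifs with h
    · have hg : g v = q ^ m v := Proc.lim_final h
      rw [hg, ← pow_add]
      rcases k + m v with _ | j
      · simp [H, start]
      · rw [pow_succ]
        exact mul_le_mul_right hq _
    · exact le_rfl
  have key : ∀ n s, (∀ k v, s = some (k, v) → T.arity v ≠ 0) →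
      (T.branching m).val 0 1 n s ≤ H s := by
    intro n
    induction n with
    | zero =>
      rintro (_ | ⟨k, v⟩) hs
      · rw [Proc.val_final rfl]; rfl
      · rw [Proc.val_zero (hs k v rfl)]; exact zero_le
    | succ n ih =>
      rintro (_ | ⟨k, v⟩) hs
      · rw [Proc.val_final rfl]; rfl
      · have hv := hs k v rfl
        have hg : g v = _ := Proc.lim_eq (Q := T.proc) hv
        rw [Proc.val_succ (Q := T.branching m) (s := some (k, v)) hv, zero_add]
        change _ ≤ q ^ k * g v
        rw [hg, zero_add, Finset.mul_sum]
        refine Finset.sum_le_sum fun i _ => ?_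
        rw [mul_left_comm]
        refine mul_le_mul_right ((ih _ ?_).trans (henter k (v ++ [i]))) _
        exact enter_inner hroot _ _
  refine iSup_le fun n => (key n _ ?_).trans ?_
  · rintro k v ⟨⟩
    exact hroot
  · simpa [H] using hq

/-- With `k` more copies waiting, the expected number of steps grows by at least the expected
number of steps for these `k` copies, weighted with the probability of getting to them. -/
theorem branching_steps_add_le (hroot : T.arity [] ≠ 0) (k : ℕ) (n : ℕ)
    (s : Option (ℕ × List ℕ)) (hs : ∀ j v, s = some (j, v) → T.arity v ≠ 0) :
    (T.branching m).val 1 0 n s + (T.branching m).val 0 1 n s *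
        (T.branching m).lim 1 0 (start k) ≤
      (T.branching m).lim 1 0 (s.elim (start k) fun p => some (p.1 + k, p.2)) := by
  have hadd (j : ℕ) (v : List ℕ) :
      (T.enter m j v).elim (start k) (fun p => some (p.1 + k, p.2)) = T.enter m (j + k) v := by
    unfold enter
    split_ifs with h
    · rw [add_right_comm]
      rcases j + m v with _ | i
      · simp [start]
      · rw [add_right_comm]; rfl
    · rfl
  induction n generalizing s with
  | zero =>
    rcases s with _ | ⟨j, v⟩
    · rw [Proc.val_final rfl, Proc.val_final rfl]; simp
    · rw [Proc.val_zero (hs j v rfl), Proc.val_zero (hs j v rfl)]; simp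
  | succ n ih =>
    rcases s with _ | ⟨j, v⟩
    · rw [Proc.val_final rfl, Proc.val_final rfl]; simp
    · have hv : (T.branching m).arity (some (j, v)) ≠ 0 := hs j v rfl
      have hv' : (T.branching m).arity (some (j + k, v)) ≠ 0 := hv
      simp only [Option.elim_some]
      rw [Proc.val_succ hv, Proc.val_succ hv, Proc.lim_eq hv', zero_add, add_assoc,
        Finset.sum_mul, ← Finset.sum_add_distrib]
      gcongr 1 + ?_
      refine Finset.sum_le_sum fun i _ => ?_
      have := ih (T.enter m j (v ++ [i])) (enter_inner hroot _ _)
      rw [hadd] at this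
      rw [mul_assoc, ← mul_add]
      exact mul_le_mul_right this _

/-- If a single copy dies out almost surely, then the expected number of steps for `k` copies is
at least `k` times the one for a single copy. -/
theorem mul_le_branching_steps (hroot : T.arity [] ≠ 0)
    (h1 : 1 ≤ (T.branching m).lim 0 1 (start 1)) (k : ℕ) :
    k * (T.branching m).lim 1 0 (start 1) ≤ (T.branching m).lim 1 0 (start k) := by
  induction k with
  | zero => simp
  | succ k ih =>
    have h2 : (T.branching m).lim 1 0 (start 1) + (T.branching m).lim 0 1 (start 1) *
        (T.branching m).lim 1 0 (start k) ≤ (T.branching m).lim 1 0 (start (k + 1)) := by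
      rw [Proc.lim, Proc.lim, ENNReal.iSup_mul, ENNReal.iSup_add_iSup_of_monotone
        (Proc.monotone_val _) fun a b hab => mul_le_mul_left (Proc.monotone_val _ hab) _]
      refine iSup_le fun n => ?_
      have := branching_steps_add_le (m := m) hroot k n (start 1) (by rintro j v ⟨⟩; exact hroot)
      simpa [start] using this
    calc ((k + 1 : ℕ) : ℝ≥0∞) * (T.branching m).lim 1 0 (start 1)
        = (T.branching m).lim 1 0 (start 1) + 1 * (k * (T.branching m).lim 1 0 (start 1)) := by
          push_cast; ring
      _ ≤ _ := le_trans (by gcongr) h2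

/-- If the mean number of copies is at least `1` and a single copy dies out almost surely, then
the expected number of steps is infinite. -/
theorem branching_steps_eq_top (hroot : T.arity [] ≠ 0)
    (h1 : 1 ≤ (T.branching m).lim 0 1 (start 1))
    (hm : 1 ≤ T.proc.lim 0 (fun v => (m v : ℝ≥0∞)) []) :
    (T.branching m).lim 1 0 (start 1) = ∞ := by
  set W := (T.branching m).lim 1 0 with hW
  have hle : ∀ n v, T.proc.val 0 (fun v => W (start (m v))) n v ≤ W (T.enter m 0 v) := by
    intro n
    induction n with
    | zero =>
      intro v
      by_cases h : T.arity v = 0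
      · rw [Proc.val_final h]; simp [enter, h]
      · rw [Proc.val_zero h]; exact zero_le
    | succ n ih =>
      intro v
      by_cases h : T.arity v = 0
      · rw [Proc.val_final h]; simp [enter, h]
      · have h' : (T.branching m).arity (some (0, v)) ≠ 0 := h
        rw [Proc.val_succ h, enter, if_neg h, hW, Proc.lim_eq h']
        exact add_le_add zero_le (Finset.sum_le_sum fun i _ => mul_le_mul_right (ih _) _)
  have hstep : 1 + T.proc.lim 0 (fun v => W (start (m v))) [] ≤ W (start 1) := by
    have h' : (T.branching m).arity (start 1) ≠ 0 := hroot
    rw [hW, Proc.lim_eq h', Proc.lim_eq hroot, zero_add]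
    exact add_le_add le_rfl (Finset.sum_le_sum fun i _ =>
      mul_le_mul_right (iSup_le fun n => hle n _) _)
  have hmul : T.proc.lim 0 (fun v => (m v : ℝ≥0∞)) [] * W (start 1) ≤
      T.proc.lim 0 (fun v => W (start (m v))) [] := by
    rw [← T.tsum_leaves, ← T.tsum_leaves, ← ENNReal.tsum_mul_right]
    refine ENNReal.tsum_le_tsum fun x => ?_
    rw [mul_assoc]
    exact mul_le_mul_right (mul_le_branching_steps hroot h1 _) _
  -- altogether `1 + W (start 1) ≤ W (start 1)`
  by_contra htop
  have : W (start 1) + 1 ≤ W (start 1) := by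
    calc W (start 1) + 1 = 1 + 1 * W (start 1) := by ring
      _ ≤ 1 + T.proc.lim 0 (fun v => (m v : ℝ≥0∞)) [] * W (start 1) := by gcongr
      _ ≤ _ := le_trans (by gcongr) hstep
  exact (ENNReal.lt_add_right htop one_ne_zero).not_ge this

end RST

/-- A generating function of a subprobability distribution with mean greater than `1` takes a value
`≤ q` at some point `q < 1`. -/
theorem exists_tsum_mul_pow_le {ι : Type*} (p : ι → ℝ≥0∞) (m : ι → ℕ) (hp : ∑' i, p i ≤ 1)
    (hm : 1 < ∑' i, p i * m i) : ∃ q < 1, ∑' i, p i * q ^ m i ≤ q := by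
  rw [ENNReal.tsum_eq_iSup_sum] at hm
  obtain ⟨F, hF⟩ := lt_iSup_iff.1 hm
  have hfin : ∀ i, p i ≠ ∞ := fun i =>
    ne_top_of_le_ne_top ENNReal.one_ne_top ((ENNReal.le_tsum i).trans hp)
  let a : ι → ℝ := fun i => (p i).toReal
  have ha : ∀ i, 0 ≤ a i := fun i => ENNReal.toReal_nonneg
  have hF' : 1 < ∑ i ∈ F, a i * m i := by
    have h2 := (ENNReal.toReal_lt_toReal ENNReal.one_ne_top
      (ENNReal.sum_ne_top.2 fun i _ => ENNReal.mul_ne_top (hfin i) (by simp))).2 hF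
    rw [ENNReal.toReal_sum fun i _ => ENNReal.mul_ne_top (hfin i) (by simp)] at h2
    simpa [a] using h2
  -- `(1 - f q) / (1 - q)` for the restriction `f` of the generating function to `F`, in a form
  -- that is continuous at `1`
  let G : ℝ → ℝ := fun q => ∑ i ∈ F, a i * ∑ j ∈ Finset.range (m i), q ^ j
  have hG : Continuous G := by fun_prop
  have hG1 : 1 < G 1 := by simpa [G] using hF'
  obtain ⟨q, hqG, hq0, hq1⟩ : ∃ q : ℝ, 1 < G q ∧ 0 < q ∧ q < 1 := by
    have e1 : ∀ᶠ q in nhdsWithin (1 : ℝ) (Set.Iio 1), 1 < G q :=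
      (hG.continuousAt.eventually_const_lt hG1).filter_mono nhdsWithin_le_nhds
    have e2 : ∀ᶠ q in nhdsWithin (1 : ℝ) (Set.Iio 1), q ∈ Set.Ioo (0 : ℝ) 1 :=
      Ioo_mem_nhdsLT one_pos
    obtain ⟨q, h1, h2⟩ := (e1.and e2).exists
    exact ⟨q, h1, h2⟩
  have hreal : ∑ i ∈ F, a i * q ^ m i + (1 - ∑ i ∈ F, a i) ≤ q := by
    have h3 : (1 - q) * G q = ∑ i ∈ F, a i - ∑ i ∈ F, a i * q ^ m i := by
      rw [← Finset.sum_sub_distrib, Finset.mul_sum]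
      refine Finset.sum_congr rfl fun i _ => ?_
      have := geom_sum_mul_neg q (m i)
      linear_combination a i * this
    nlinarith
  have hsum1 : ∑ i ∈ F, p i = ENNReal.ofReal (∑ i ∈ F, a i) := by
    rw [ENNReal.ofReal_sum_of_nonneg fun i _ => ha i]
    exact Finset.sum_congr rfl fun i _ => (ENNReal.ofReal_toReal (hfin i)).symm
  have hsum2 : ∑ i ∈ F, p i * ENNReal.ofReal q ^ m i =
      ENNReal.ofReal (∑ i ∈ F, a i * q ^ m i) := by
    rw [ENNReal.ofReal_sum_of_nonneg fun i _ => mul_nonneg (ha i) (pow_nonneg hq0.le _)]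
    refine Finset.sum_congr rfl fun i _ => ?_
    rw [ENNReal.ofReal_mul (ha i), ENNReal.ofReal_pow hq0.le, ENNReal.ofReal_toReal (hfin i)]
  have hle1 : ∑ i ∈ F, a i ≤ 1 := by
    have := (ENNReal.sum_le_tsum F).trans hp
    rw [hsum1] at this
    exact ENNReal.ofReal_le_one.1 this
  refine ⟨ENNReal.ofReal q, ENNReal.ofReal_lt_one.2 hq1, ?_⟩
  have hcompl : ∑' i : ((F : Set ι)ᶜ : Set ι), p i ≤ ENNReal.ofReal (1 - ∑ i ∈ F, a i) := by
    rw [ENNReal.ofReal_sub _ (Finset.sum_nonneg fun i _ => ha i), ENNReal.ofReal_one, ← hsum1]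
    refine ENNReal.le_sub_of_add_le_left (by rw [hsum1]; exact ENNReal.ofReal_ne_top) ?_
    exact (ENNReal.sum_add_tsum_compl F _).trans_le hp
  calc ∑' i, p i * ENNReal.ofReal q ^ m i
      = ∑ i ∈ F, p i * ENNReal.ofReal q ^ m i +
          ∑' i : ((F : Set ι)ᶜ : Set ι), p i * ENNReal.ofReal q ^ m i :=
        (ENNReal.sum_add_tsum_compl F _).symm
    _ ≤ ENNReal.ofReal (∑ i ∈ F, a i * q ^ m i) + ENNReal.ofReal (1 - ∑ i ∈ F, a i) := by
        rw [← hsum2]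
        gcongr
        refine le_trans (ENNReal.tsum_le_tsum fun i => ?_) hcompl
        exact mul_le_of_le_one_right' (pow_le_one' (ENNReal.ofReal_le_one.2 hq1.le) _)
    _ ≤ ENNReal.ofReal q := by
        rw [← ENNReal.ofReal_add (Finset.sum_nonneg fun i _ =>
          mul_nonneg (ha i) (pow_nonneg hq0.le _)) (by linarith)]
        exact ENNReal.ofReal_le_ofReal hreal

/-! ### Realizing the branching process by rewriting -/

section Realize

variable {L : FirstOrder.Language.{u, v}} {V : Type w} {P : PTRS L V}

/-- The term `a` realizes a state of the branching process of the tree `T` whose root is labeled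
with `t`: there are occurrences of `t` in `a` at pairwise orthogonal positions, one for each waiting
copy, and, at a position orthogonal to them, an instance of the term at the current node. -/
def Realizes (T : RST P.toPARS) (t a : L.Term V) : Option (ℕ × List ℕ) → Prop
  | none => True
  | some (k, v) => v ∈ T.nodes ∧ ∃ (Θ : Finset (List ℕ)) (π : List ℕ) (σ : Substitution L V),
      Θ.card = k ∧ (∀ π₁ ∈ Θ, ∀ π₂ ∈ Θ, π₁ ≠ π₂ → Orthogonal π₁ π₂) ∧
      (∀ π₁ ∈ Θ, OccursAt t π₁ a ∧ Orthogonal π π₁) ∧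
      subtermAt a π = some (σ.apply (T.label v))

variable {T : RST P.toPARS} {t a : L.Term V}

/-- A term with `k` pairwise orthogonal occurrences of `t` realizes the state of `k` copies. -/
theorem realizes_start (ht : T.root = t) {Θ : Finset (List ℕ)}
    (hΘ : ∀ π₁ ∈ Θ, ∀ π₂ ∈ Θ, π₁ ≠ π₂ → Orthogonal π₁ π₂) (hocc : ∀ π ∈ Θ, OccursAt t π a) :
    Realizes T t a (RST.start Θ.card) := by
  classical
  rcases hc : Θ.card with _ | k
  · trivial
  · obtain ⟨π, hπ⟩ : Θ.Nonempty := Finset.card_pos.1 (by omega)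
    obtain ⟨σ, hσ⟩ := hocc π hπ
    refine ⟨T.root_mem, Θ.erase π, π, σ, ?_, ?_, ?_, ?_⟩
    · rw [Finset.card_erase_of_mem hπ, hc]; rfl
    · exact fun π₁ h₁ π₂ h₂ => hΘ π₁ (Finset.mem_of_mem_erase h₁) π₂ (Finset.mem_of_mem_erase h₂)
    · intro π₁ h₁
      have h₁' := Finset.mem_erase.1 h₁
      exact ⟨hocc π₁ h₁'.2, hΘ π hπ π₁ h₁'.2 h₁'.1.symm⟩
    · rw [hσ, ← ht]; rfl

/-- The steps of the branching process can be simulated by rewriting: the step at a node of `T` is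
performed at the instance of its label, which leaves the orthogonal occurrences of `t` intact, and
at a leaf the orthogonal occurrences of `t` in its label become new copies. -/
theorem realizes_step (ht : T.root = t) {s : Option (ℕ × List ℕ)} (ha : Realizes T t a s)
    (h0 : (T.branching fun v => maxOO t (T.label v)).arity s ≠ 0) :
    ∃ b : ℕ → L.Term V,
      (∀ i < (T.branching fun v => maxOO t (T.label v)).arity s,
        Realizes T t (b i) ((T.branching fun v => maxOO t (T.label v)).next s i)) ∧
      ∃ μ : FDist (L.Term V), P.toPARS a μ ∧
        μ.pairs = (Multiset.range ((T.branching fun v => maxOO t (T.label v)).arity s)).map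
          (fun i => ((T.branching fun v => maxOO t (T.label v)).wt s i, b i)) := by
  classical
  rcases s with _ | ⟨k, v⟩
  · exact absurd rfl h0
  obtain ⟨hv, Θ, π, σ, hcard, horth, hocc, hπ⟩ := ha
  obtain ⟨μ, hR, hμ⟩ := T.step v hv h0
  obtain ⟨μ', hR', hμ'⟩ := PTRS.toPARS_replaceAt hR hπ
  refine ⟨fun i => replaceAt a π (σ.apply (T.label (v ++ [i]))), fun i hi => ?_, μ', hR', ?_⟩
  · set b := replaceAt a π (σ.apply (T.label (v ++ [i]))) with hb
    have hvi : v ++ [i] ∈ T.nodes := (T.append_mem_iff _ _).2 ⟨hv, hi⟩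
    have hbπ : subtermAt b π = some (σ.apply (T.label (v ++ [i]))) :=
      subtermAt_replaceAt_self hπ _
    have hoccb : ∀ π₁ ∈ Θ, OccursAt t π₁ b := fun π₁ h₁ => by
      obtain ⟨τ, hτ⟩ := (hocc π₁ h₁).1
      exact ⟨τ, by rw [hb, subtermAt_replaceAt_of_orthogonal _ _ (hocc π₁ h₁).2, hτ]⟩
    change Realizes T t b (T.enter (fun v => maxOO t (T.label v)) k (v ++ [i]))
    unfold RST.enter
    split_ifs with hleaf
    · obtain ⟨S, ⟨-, hSocc, -⟩, hSorth, hScard⟩ := (isGreatest_maxOO t (T.label (v ++ [i]))).1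
      have hinj : Set.InjOn (π ++ ·) (S : Set (List ℕ)) := (List.append_right_injective π).injOn
      have hdisj : Disjoint Θ (S.image (π ++ ·)) := by
        rw [Finset.disjoint_left]
        intro π₁ h₁ h₂
        obtain ⟨τ, -, rfl⟩ := Finset.mem_image.1 h₂
        exact (hocc _ h₁).2.1 (List.prefix_append π τ)
      have hc : (Θ ∪ S.image (π ++ ·)).card = k + maxOO t (T.label (v ++ [i])) := by
        rw [Finset.card_union_of_disjoint hdisj, Finset.card_image_of_injOn hinj, hcard, hScard]
      rw [← hc]
      refine realizes_start ht ?_ ?_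
      · intro π₁ h₁ π₂ h₂ hne
        rcases Finset.mem_union.1 h₁ with h₁ | h₁ <;> rcases Finset.mem_union.1 h₂ with h₂ | h₂
        · exact horth π₁ h₁ π₂ h₂ hne
        · obtain ⟨τ, -, rfl⟩ := Finset.mem_image.1 h₂
          exact ((hocc _ h₁).2.append_left τ).symm
        · obtain ⟨τ, -, rfl⟩ := Finset.mem_image.1 h₁
          exact (hocc _ h₂).2.append_left τ
        · obtain ⟨τ₁, hτ₁, rfl⟩ := Finset.mem_image.1 h₁
          obtain ⟨τ₂, hτ₂, rfl⟩ := Finset.mem_image.1 h₂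
          exact (hSorth τ₁ hτ₁ τ₂ hτ₂ fun h => hne (by rw [h])).append_append π
      · intro π₁ h₁
        rcases Finset.mem_union.1 h₁ with h₁ | h₁
        · exact hoccb π₁ h₁
        · obtain ⟨τ, hτ, rfl⟩ := Finset.mem_image.1 h₁
          obtain ⟨σ', hσ'⟩ := hSocc τ hτ
          refine ⟨σ.comp σ', ?_⟩
          rw [subtermAt_append, hbπ, Option.bind_some, Substitution.comp_apply]
          exact subtermAt_subst hσ' σ.toFun
    · exact ⟨hvi, Θ, π, σ, hcard, horth, fun π₁ h₁ => ⟨hoccb π₁ h₁, (hocc π₁ h₁).2⟩, hbπ⟩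
  · rw [hμ', hμ, Multiset.map_map]
    rfl

end Realize

end ProbRewriting

theorem mainTheorem4 {L : FirstOrder.Language.{u, v}} [Finite (Σ n, L.Functions n)]
    {V : Type w} [Infinite V] (P : ProbRewriting.PTRS L V)
    (T : ProbRewriting.RST P.toPARS) (hT : 0 < T.height)
    (t : L.Term V) (ht : T.root = t) :
    (1 < ∑' x : T.leaves,
        ENNReal.ofReal (T.prob x) * (ProbRewriting.maxOO t (T.label x) : ℝ≥0∞) →
      ¬ P.toPARS.IsAST) ∧
    (1 ≤ ∑' x : T.leaves,
        ENNReal.ofReal (T.prob x) * (ProbRewriting.maxOO t (T.label x) : ℝ≥0∞) →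
      ¬ P.toPARS.IsPAST) := by
  have hroot := T.arity_root_ne_zero hT
  set m : List ℕ → ℕ := fun v => ProbRewriting.maxOO t (T.label v) with hm
  have hinit : ProbRewriting.Realizes T t t (some (0, [])) := by
    refine ⟨T.root_mem, ∅, [], ProbRewriting.Substitution.id L V, rfl, by simp, by simp, ?_⟩
    rw [ProbRewriting.subtermAt_nil, ← ht]
    exact congrArg some (ProbRewriting.subst_var _).symm
  have htree := ProbRewriting.RST.exists_of_simulation (T.branching m)
    (ProbRewriting.Realizes T t) fun a s => ProbRewriting.realizes_step ht
  constructor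
  · intro h hAST
    obtain ⟨q, hq1, hq⟩ := ProbRewriting.exists_tsum_mul_pow_le
      (fun x : T.leaves => ENNReal.ofReal (T.prob x)) (fun x => m x) T.termProb_le_one h
    rw [T.tsum_leaves (fun x => q ^ m x)] at hq
    obtain ⟨T', φ, hφ, -, hval⟩ := htree t _ hinit
    have h1 : T'.termProb = (T.branching m).lim 0 1 (some (0, [])) := by
      rw [T'.termProb_eq, ← hφ]
      exact iSup_congr fun n => hval 0 1 n [] T'.root_mem
    have h2 := ProbRewriting.RST.branching_lim_one_le hroot hq
    rw [← h1, hAST T'] at h2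
    exact h2.not_gt hq1
  · intro h hPAST
    have hone : ∀ a s, ProbRewriting.Realizes T t a s → 1 ≤ (T.branching m).lim 0 1 s := by
      intro a s hs
      obtain ⟨T', φ, hφ, -, hval⟩ := htree a s hs
      have h1 : T'.termProb = (T.branching m).lim 0 1 s := by
        rw [T'.termProb_eq, ← hφ]
        exact iSup_congr fun n => hval 0 1 n [] T'.root_mem
      rw [← h1]
      by_contra hlt
      have := hPAST T'
      rw [ProbRewriting.RST.edl, if_pos (not_le.1 hlt)] at this
      exact lt_irrefl _ this
    obtain ⟨T', φ, hφ, hinv, hval⟩ := htree t _ hinit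
    have h1 : ∀ x ∈ T'.nodes, 1 ≤ T'.proc.lim 0 1 x := fun x hx => by
      refine (hone _ _ (hinv x hx)).trans_eq ?_
      exact iSup_congr fun n => (hval 0 1 n x hx).symm
    have h2 : T'.proc.lim 1 0 [] = ∞ := by
      rw [T.tsum_leaves (fun x => (m x : ℝ≥0∞))] at h
      rw [← ProbRewriting.RST.branching_steps_eq_top hroot (hone t _ hinit) h]
      refine iSup_congr fun n => (hval 1 0 n [] T'.root_mem).trans ?_
      rw [hφ]
      rfl
    exact (hPAST T').not_ge (h2 ▸ T'.lim_steps_le_edl h1)
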